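/- For $A\subseteq\mathbb Z^+$ let $\mathrm{Dim}_\zeta(A)=\inf\{s\ge 0 : \sum_{n\in A}n^{-s}<\infty\}$, and let $F_A=\{f:\mathbb N\to\mathbb N \mid f(\mathbb N)\subseteq A \text{ and } \lim_{n\to\infty}f(n)=\infty\}$, where $\mathbb N=\{0,1,2,\dots\}$. For $z\in\mathbb N^{\mathbb N}$ put $$\mathrm{real}(z)=\cfrac{1}{(z_0+1)+\cfrac{1}{(z_1+1)+\dotsb}}\in[0,1].$$ Let $\gamma(E)=\frac1{\ln 2}\int_E\frac{dt}{1+t}$ for $E\subseteq[0,1]$ be the Gauss measure. For a finite word $w$ over $\mathbb N$ let $\gamma(w)=\gamma(\mathrm{real}(C_w))$, where $C_w\subseteq\mathbb N^{\mathbb N}$ is the set of sequences with prefix $w$. Equip $\mathbb N^{\mathbb N}$ with the metric $\rho$ given by $\rho(z,z)=0$ and, for $z\ne z'$, $\rho(z,z')=\gamma(w)$, where $w$ is the longest common prefix of $z$ and $z'$. Let $\dim_\gamma$ be the Hausdorff dimension with respect to $\rho$. Let $\mathrm{Dim}_\gamma$ be the packing dimension with respect to $\rho$, in its diameter-based form: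 for $s\ge0$ let $$P^s_0(E)=\lim_{\delta\to0^+}\sup\Big\{\sum_i(\operatorname{diam}B_i)^s\Big\},$$ the supremum being over all countable families of pairwise disjoint closed balls $B_i$ with centres in $E$ and radii in $(0,\delta]$; let $P^s(E)=\inf\{\sum_{i}P^s_0(E_i): E\subseteq\bigcup_{i\in\mathbb N}E_i\}$, and let $\mathrm{Dim}_\gamma(E)=\sup\{s\ge0:P^s(E)=\infty\}$, with $\sup\varnothing=0$. Then for every $A\subseteq\mathbb Z^+$, $$\mathrm{Dim}_\zeta(A)=2\cdot\dim_\gamma(F_A)=2\cdot\mathrm{Dim}_\gamma(F_A).$$ -/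

import Mathlib

open MeasureTheory Set Filter Topology
open scoped ENNReal NNReal

/-! ### Zeta-dimension of sets of positive integers -/

/-- The series `ζ_A(s) = ∑_{n ∈ A} n^{-s}`, with values in `[0, ∞]`. -/
noncomputable def zetaSum (A : Set ℕ+) (s : ℝ≥0) : ℝ≥0∞ :=
  ∑' n : A, (((n : ℕ+) : ℕ) : ℝ≥0∞) ^ (-(s : ℝ))

/-- The zeta-dimension `inf {s ≥ 0 | ζ_A(s) < ∞}`. -/
noncomputable def zetaDim (A : Set ℕ+) : ℝ≥0∞ :=
  ⨅ (s : ℝ≥0) (_ : zetaSum A s < ∞), (s : ℝ≥0∞)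

/-! ### Packing dimension in a metric space -/

section Packing

variable {X : Type*} [MetricSpace X]

/-- `P` is a `δ`-packing of `E`: an at most countable family of pairwise disjoint closed balls with
centres in `E` and radii in `(0, δ]`; the pair `(x, r)` stands for the ball `closedBall x r`. -/
def IsBallPacking (δ : ℝ) (E : Set X) (P : Set (X × ℝ)) : Prop :=
  P.Countable ∧ (∀ b ∈ P, b.1 ∈ E ∧ 0 < b.2 ∧ b.2 ≤ δ) ∧
    P.PairwiseDisjoint fun b => Metric.closedBall b.1 b.2

/-- The supremum of `∑ (diam B)^s` over all `δ`-packings of `E`. -/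
noncomputable def packingPreAt (s : ℝ≥0) (δ : ℝ) (E : Set X) : ℝ≥0∞ :=
  ⨆ (P : Set (X × ℝ)) (_ : IsBallPacking δ E P),
    ∑' b : P, Metric.ediam (Metric.closedBall (b : X × ℝ).1 (b : X × ℝ).2) ^ (s : ℝ)

/-- The `s`-dimensional packing premeasure, the limit of `packingPreAt s δ E` as `δ → 0+`. -/
noncomputable def packingPre (s : ℝ≥0) (E : Set X) : ℝ≥0∞ :=
  ⨅ (δ : ℝ) (_ : 0 < δ), packingPreAt s δ E

/-- The `s`-dimensional packing (outer) measure. -/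
noncomputable def packingMeas (s : ℝ≥0) (E : Set X) : ℝ≥0∞ :=
  ⨅ (U : ℕ → Set X) (_ : E ⊆ ⋃ i, U i), ∑' i, packingPre s (U i)

/-- The packing dimension `sup {s ≥ 0 | P^s(E) = ∞}`, with `sup ∅ = 0`. -/
noncomputable def packingDim (E : Set X) : ℝ≥0∞ :=
  ⨆ (s : ℝ≥0) (_ : packingMeas s E = ∞), (s : ℝ≥0∞)

end Packing

/-! ### Continued fractions and Gauss measure on Baire space -/

/-- The finite continued fraction `1/((z 0 + 1) + 1/((z 1 + 1) + ⋯ + 1/((z (n-1) + 1) + x)))`. -/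
noncomputable def cfTail : ℕ → (ℕ → ℕ) → ℝ → ℝ
  | 0, _, x => x
  | n + 1, z, x => 1 / ((z 0 : ℝ) + 1 + cfTail n (fun i => z (i + 1)) x)

/-- The infinite continued fraction `1/((z 0 + 1) + 1/((z 1 + 1) + ⋯))`, the limit of its
convergents. (The convergents always converge, see `tendsto_cfTail`.) -/
noncomputable def cfReal (z : ℕ → ℕ) : ℝ := limUnder atTop fun n => cfTail n z 0

/-- The Gauss measure `γ(E) = (1 / ln 2) ∫_E dt / (1 + t)` on `[0, 1]`. -/
noncomputable def gaussMeasure : Measure ℝ :=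
  (volume.restrict (Icc (0 : ℝ) 1)).withDensity
    fun t => ENNReal.ofReal (1 / Real.log 2 * (1 / (1 + t)))

/-- `γ(w)` for the word `w = z 0, …, z (n-1)`: the Gauss measure of the set of reals whose
continued fraction expansion starts with `w`. -/
noncomputable def gaussCyl (z : ℕ → ℕ) (n : ℕ) : ℝ≥0∞ :=
  gaussMeasure (cfReal '' PiNat.cylinder z n)

theorem cfTail_mem {n : ℕ} : ∀ {z : ℕ → ℕ} {x : ℝ}, x ∈ Icc (0 : ℝ) 1 →
    cfTail n z x ∈ Icc (0 : ℝ) 1 := by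
  induction n with
  | zero => intro z x hx; exact hx
  | succ n ih =>
    intro z x hx
    have h := (ih (z := fun i => z (i + 1)) hx).1
    have hz : (0 : ℝ) ≤ z 0 := by positivity
    simp only [cfTail]
    refine ⟨by positivity, ?_⟩
    rw [div_le_one (by positivity)]
    linarith

theorem abs_cfTail_sub_le (n : ℕ) : ∀ (z : ℕ → ℕ) {x y : ℝ}, x ∈ Icc (0 : ℝ) 1 →
    y ∈ Icc (0 : ℝ) 1 → |cfTail n z x - cfTail n z y| ≤ 2 * (1 / 2) ^ n := by
  induction n using Nat.strong_induction_on with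
  | _ n ih =>
    intro z x y hx hy
    match n, ih with
    | 0, _ =>
      have h1 := cfTail_mem (n := 0) (z := z) hx
      have h2 := cfTail_mem (n := 0) (z := z) hy
      rw [abs_le]
      constructor <;> norm_num <;> linarith [h1.1, h1.2, h2.1, h2.2]
    | 1, _ =>
      have h1 := cfTail_mem (n := 1) (z := z) hx
      have h2 := cfTail_mem (n := 1) (z := z) hy
      rw [abs_le]
      constructor <;> norm_num <;> linarith [h1.1, h1.2, h2.1, h2.2]
    | n + 2, ih =>
      have hd := ih n (by omega) (fun i => z (i + 1 + 1)) hx hy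
      have hu := cfTail_mem (n := n) (z := fun i => z (i + 1 + 1)) hx
      have hv := cfTail_mem (n := n) (z := fun i => z (i + 1 + 1)) hy
      simp only [cfTail]
      set u := cfTail n (fun i => z (i + 1 + 1)) x
      set v := cfTail n (fun i => z (i + 1 + 1)) y
      set a : ℝ := (z 0 : ℝ) + 1
      set b : ℝ := (z (0 + 1) : ℝ) + 1
      have ha : 1 ≤ a := by simp [a]
      have hb : 1 ≤ b := by simp [b]
      have hu0 := hu.1
      have hv0 := hv.1
      have hbu : 0 < b + u := by linarith
      have hbv : 0 < b + v := by linarith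
      have hU : 2 ≤ a * (b + u) + 1 := by nlinarith
      have hV : 2 ≤ a * (b + v) + 1 := by nlinarith
      have e : 1 / (a + 1 / (b + u)) - 1 / (a + 1 / (b + v))
          = (u - v) / ((a * (b + u) + 1) * (a * (b + v) + 1)) := by
        have h1 : a + 1 / (b + u) = (a * (b + u) + 1) / (b + u) := by field_simp
        have h2 : a + 1 / (b + v) = (a * (b + v) + 1) / (b + v) := by field_simp
        rw [h1, h2, one_div_div, one_div_div, div_sub_div _ _ (by linarith) (by linarith)]
        congr 1
        ring
      have hUV : 4 ≤ (a * (b + u) + 1) * (a * (b + v) + 1) := by nlinarith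
      rw [e, abs_div, abs_of_pos (a := (a * (b + u) + 1) * (a * (b + v) + 1)) (by linarith),
        div_le_iff₀ (by linarith)]
      have hp : (0 : ℝ) < (1 / 2) ^ n := by positivity
      have : 2 * (1 / 2 : ℝ) ^ (n + 2) * 4 = 2 * (1 / 2) ^ n := by ring
      nlinarith

theorem cfTail_add (n k : ℕ) : ∀ (z : ℕ → ℕ) (x : ℝ),
    cfTail (n + k) z x = cfTail n z (cfTail k (fun i => z (i + n)) x) := by
  induction n with
  | zero => intro z x; simp [cfTail]
  | succ n ih =>
    intro z x
    rw [show n + 1 + k = (n + k) + 1 by ring]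
    simp only [cfTail, ih]
    simp only [Nat.add_assoc]

theorem tendsto_cfTail (z : ℕ → ℕ) :
    Tendsto (fun n => cfTail n z 0) atTop (𝓝 (cfReal z)) := by
  have h01 : (0 : ℝ) ∈ Icc (0 : ℝ) 1 := by simp
  have hc : CauchySeq fun n => cfTail n z 0 := by
    refine cauchySeq_of_le_tendsto_0 (fun n => 2 * (2 * (1 / 2 : ℝ) ^ n)) ?_ ?_
    · intro n m N hn hm
      obtain ⟨k, rfl⟩ := Nat.exists_eq_add_of_le hn
      obtain ⟨l, rfl⟩ := Nat.exists_eq_add_of_le hm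
      rw [Real.dist_eq, cfTail_add, cfTail_add]
      refine (abs_cfTail_sub_le N z (cfTail_mem h01) (cfTail_mem h01)).trans ?_
      have hp : (0 : ℝ) < (1 / 2) ^ N := by positivity
      linarith
    · have := tendsto_pow_atTop_nhds_zero_of_lt_one (r := (1 / 2 : ℝ)) (by norm_num) (by norm_num)
      simpa using (this.const_mul 2).const_mul 2
  exact hc.tendsto_limUnder

theorem cfReal_mem (z : ℕ → ℕ) : cfReal z ∈ Icc (0 : ℝ) 1 :=
  isClosed_Icc.mem_of_tendsto (tendsto_cfTail z)
    (Eventually.of_forall fun _ => cfTail_mem (by simp))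

theorem cfReal_eq (z : ℕ → ℕ) :
    cfReal z = 1 / ((z 0 : ℝ) + 1 + cfReal fun i => z (i + 1)) := by
  have h1 := (tendsto_cfTail z).comp (tendsto_add_atTop_nat 1)
  have h0 := (cfReal_mem fun i => z (i + 1)).1
  have hz : (0 : ℝ) ≤ z 0 := by positivity
  have h2 := tendsto_const_nhds (x := (1 : ℝ)) |>.div
    ((tendsto_cfTail fun i => z (i + 1)).const_add ((z 0 : ℝ) + 1)) (by positivity)
  exact tendsto_nhds_unique h1 h2

/-- One step of the continued fraction algorithm: every irrational number in `[0, 1]` is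
`1 / (k + 1 + y)` with `y` again an irrational number in `[0, 1]`. -/
theorem exists_cf_step (x : {x : ℝ // Irrational x ∧ x ∈ Icc (0 : ℝ) 1}) :
    ∃ p : ℕ × {x : ℝ // Irrational x ∧ x ∈ Icc (0 : ℝ) 1},
      (x : ℝ) = 1 / ((p.1 : ℝ) + 1 + (p.2 : ℝ)) := by
  obtain ⟨x, hi, hx⟩ := x
  have hx0 : 0 < x := lt_of_le_of_ne hx.1 fun h => hi.ne_zero h.symm
  have h1 : 1 ≤ 1 / x := by rw [le_div_iff₀ hx0]; linarith [hx.2]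
  have hf : 1 ≤ ⌊1 / x⌋₊ := by rwa [Nat.one_le_floor_iff]
  have hle := Nat.floor_le (a := 1 / x) (by linarith)
  have hlt := Nat.lt_floor_add_one (1 / x)
  refine ⟨(⌊1 / x⌋₊ - 1, ⟨1 / x - ⌊1 / x⌋₊, ?_, ?_, ?_⟩), ?_⟩
  · rw [one_div]; exact hi.inv.sub_natCast _
  · linarith
  · linarith
  · simp only [Nat.cast_sub hf, Nat.cast_one]
    rw [show (⌊1 / x⌋₊ : ℝ) - 1 + 1 + (1 / x - ⌊1 / x⌋₊) = 1 / x by ring, one_div_one_div]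

theorem irrational_mem_range_cfReal {x : ℝ} (hi : Irrational x) (hx : x ∈ Icc (0 : ℝ) 1) :
    x ∈ range cfReal := by
  choose f hf using exists_cf_step
  let T : ℕ → {x : ℝ // Irrational x ∧ x ∈ Icc (0 : ℝ) 1} :=
    fun n => (fun y => (f y).2)^[n] ⟨x, hi, hx⟩
  let z : ℕ → ℕ := fun n => (f (T n)).1
  have hT : ∀ n, ((T n : ℝ)) = 1 / ((z n : ℝ) + 1 + (T (n + 1) : ℝ)) := by
    intro n
    have := hf (T n)
    simpa only [z, T, Function.iterate_succ_apply'] using this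
  have key : ∀ n k, ((T k : ℝ)) = cfTail n (fun i => z (i + k)) (T (k + n)) := by
    intro n
    induction n with
    | zero => intro k; simp [cfTail]
    | succ n ih =>
      intro k
      rw [hT k, ih (k + 1)]
      simp only [cfTail, Nat.zero_add]
      simp only [Nat.add_assoc, Nat.add_comm 1]
  refine ⟨z, tendsto_nhds_unique (tendsto_cfTail z) ?_⟩
  have hb : ∀ n, |cfTail n z 0 - x| ≤ 2 * (1 / 2) ^ n := by
    intro n
    have h := key n 0
    simp only [Nat.add_zero, Nat.zero_add] at h
    have hx' : x = cfTail n z (T n) := h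
    rw [hx']
    exact abs_cfTail_sub_le n z (by simp) (T n).2.2
  rw [tendsto_iff_dist_tendsto_zero]
  refine squeeze_zero (fun _ => dist_nonneg) (fun n => (Real.dist_eq _ _).trans_le (hb n)) ?_
  have := tendsto_pow_atTop_nhds_zero_of_lt_one (r := (1 / 2 : ℝ)) (by norm_num) (by norm_num)
  simpa using this.const_mul 2

theorem volume_cfReal_image_ne_zero (n : ℕ) : ∀ z : ℕ → ℕ,
    volume (cfReal '' PiNat.cylinder z n) ≠ 0 := by
  induction n with
  | zero =>
    intro z h
    rw [PiNat.cylinder_zero, image_univ] at h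
    have hsub : Icc (0 : ℝ) 1 ⊆ range cfReal ∪ {x | Irrational x}ᶜ := by
      intro x hx
      by_cases hi : Irrational x
      · exact Or.inl (irrational_mem_range_cfReal hi hx)
      · exact Or.inr hi
    have hq : volume ({x : ℝ | Irrational x}ᶜ) = 0 := by
      have : ({x : ℝ | Irrational x}ᶜ) = range ((↑) : ℚ → ℝ) := by
        ext x; simp [Irrational]
      rw [this]
      exact (countable_range _).measure_zero _
    have h0 := measure_mono_null hsub (measure_union_null h hq)
    simp at h0
  | succ n ih =>
    intro z h
    refine ih (fun i => z (i + 1)) ?_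
    set S := cfReal '' PiNat.cylinder z (n + 1)
    have hS0 : ∀ x ∈ S, x ≠ 0 := by
      rintro _ ⟨y, -, rfl⟩
      rw [cfReal_eq]
      have h0 := (cfReal_mem fun i => y (i + 1)).1
      positivity
    have hd : DifferentiableOn ℝ (fun x : ℝ => x⁻¹ - ((z 0 : ℝ) + 1)) S := by
      intro x hx
      exact ((differentiableAt_inv (hS0 x hx)).sub_const _).differentiableWithinAt
    refine measure_mono_null ?_
      (addHaar_image_eq_zero_of_differentiableOn_of_addHaar_eq_zero volume hd h)
    rintro _ ⟨y, hy, rfl⟩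
    let y' : ℕ → ℕ := fun i => Nat.casesOn i (z 0) y
    refine ⟨cfReal y', ⟨y', ?_, rfl⟩, ?_⟩
    · intro i hi
      cases i with
      | zero => rfl
      | succ i => exact hy i (by omega)
    · have : cfReal y' = 1 / ((z 0 : ℝ) + 1 + cfReal y) := cfReal_eq y'
      simp only [this, one_div, inv_inv]
      ring

theorem gaussMeasure_lt_top (S : Set ℝ) : gaussMeasure S < ∞ := by
  refine (measure_mono (subset_univ S)).trans_lt ?_
  rw [gaussMeasure, withDensity_apply _ MeasurableSet.univ, Measure.restrict_univ]
  refine (setLIntegral_mono' (g := fun _ => ENNReal.ofReal (1 / Real.log 2)) measurableSet_Icc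
    fun t ht => ENNReal.ofReal_le_ofReal ?_).trans_lt ?_
  · have hl : 0 < Real.log 2 := Real.log_pos one_lt_two
    have h1 : 1 / (1 + t) ≤ 1 := by
      rw [div_le_one (by linarith [ht.1])]; linarith [ht.1]
    exact mul_le_of_le_one_right (by positivity) h1
  · simp

theorem gaussCyl_pos (z : ℕ → ℕ) (n : ℕ) : gaussCyl z n ≠ 0 := by
  intro h
  have hac : volume.restrict (Icc (0 : ℝ) 1) ≪ gaussMeasure := by
    refine withDensity_absolutelyContinuous' (by fun_prop) ?_
    filter_upwards [ae_restrict_mem measurableSet_Icc] with t ht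
    have hl : 0 < Real.log 2 := Real.log_pos one_lt_two
    have ht0 := ht.1
    rw [Ne, ENNReal.ofReal_eq_zero, not_le]
    positivity
  have h0 := hac h
  rw [Measure.restrict_eq_self _ (by rintro _ ⟨y, -, rfl⟩; exact cfReal_mem y)] at h0
  exact volume_cfReal_image_ne_zero n z h0

theorem gaussCyl_anti (z : ℕ → ℕ) {m n : ℕ} (h : m ≤ n) : gaussCyl z n ≤ gaussCyl z m :=
  measure_mono (image_mono (PiNat.cylinder_anti z h))

open Classical in
/-- `ρ(z, z') = γ(w)` for the longest common prefix `w` of `z ≠ z'`, and `ρ(z, z) = 0`.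
Here `PiNat.firstDiff z z'` is the length of `w`. -/
noncomputable def gaussDist (z z' : ℕ → ℕ) : ℝ :=
  if z = z' then 0 else (gaussCyl z (PiNat.firstDiff z z')).toReal

theorem gaussDist_comm (z z' : ℕ → ℕ) : gaussDist z z' = gaussDist z' z := by
  unfold gaussDist gaussCyl
  by_cases h : z = z'
  · subst h; rfl
  · rw [if_neg h, if_neg (Ne.symm h), PiNat.firstDiff_comm z' z,
      PiNat.cylinder_eq_cylinder_of_le_firstDiff z z' le_rfl]

theorem gaussDist_nonneg (z z' : ℕ → ℕ) : 0 ≤ gaussDist z z' := by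
  unfold gaussDist
  split_ifs <;> positivity

theorem gaussDist_triangle (x y z : ℕ → ℕ) :
    gaussDist x z ≤ gaussDist x y + gaussDist y z := by
  by_cases hxz : x = z
  · have h1 := gaussDist_nonneg x y
    have h2 := gaussDist_nonneg y z
    simp only [gaussDist, if_pos hxz] at *
    linarith
  by_cases hxy : x = y
  · subst hxy; simp [gaussDist]
  by_cases hyz : y = z
  · subst hyz; simp [gaussDist]
  have h1 := gaussDist_nonneg x y
  have h2 := gaussDist_nonneg y z
  have fin : ∀ u n, gaussCyl u n ≠ ∞ := fun u n => (gaussMeasure_lt_top _).ne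
  rcases min_le_iff.1 (PiNat.min_firstDiff_le x y z hxz) with h | h
  · have : gaussDist x z ≤ gaussDist x y := by
      simp only [gaussDist, if_neg hxz, if_neg hxy]
      exact ENNReal.toReal_mono (fin _ _) (gaussCyl_anti x h)
    linarith
  · have : gaussDist x z ≤ gaussDist y z := by
      rw [gaussDist_comm x z, gaussDist_comm y z]
      simp only [gaussDist, if_neg (Ne.symm hxz), if_neg (Ne.symm hyz)]
      rw [PiNat.firstDiff_comm z x, PiNat.firstDiff_comm z y]
      exact ENNReal.toReal_mono (fin _ _) (gaussCyl_anti z h)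
    linarith

/-- Baire space, the space of all functions `ℕ → ℕ`, as a type that carries the metric
`ρ(z, z') = γ(w)`, where `w` is the longest common prefix of `z ≠ z'`. -/
@[ext]
structure GaussBaire where
  /-- The underlying function. -/
  seq : ℕ → ℕ

noncomputable instance GaussBaire.instMetricSpace : MetricSpace GaussBaire where
  dist x y := gaussDist x.seq y.seq
  dist_self x := by simp [gaussDist]
  dist_comm x y := gaussDist_comm x.seq y.seq
  dist_triangle x y z := gaussDist_triangle x.seq y.seq z.seq
  eq_of_dist_eq_zero {x y} h := by
    refine GaussBaire.ext ?_
    by_contra hne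
    have h' : gaussDist x.seq y.seq = 0 := h
    simp only [gaussDist] at h'
    rw [if_neg hne, ENNReal.toReal_eq_zero_iff] at h'
    exact h'.elim (gaussCyl_pos _ _) (gaussMeasure_lt_top _).ne

/-- `F_A`: the functions `f : ℕ → ℕ` with all values in `A` and with `f n → ∞`. -/
def escapingSet (A : Set ℕ+) : Set GaussBaire :=
  {f | (∀ n, f.seq n ∈ ((↑) : ℕ+ → ℕ) '' A) ∧ Tendsto f.seq atTop atTop}

/-! The exponents rest on one two-sided estimate: `(1/4) ∏ (z i + 2)^(-2) ≤ γ(w) ≤ 2 ∏ (z i +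
1)^(-2)` for the word `w = z 0, …, z (n-1)` (`prod_le_gaussCyl`, `gaussCyl_le_prod`). The constants
do not depend on the length of the word, so a sum of `γ(w)^(s/2)` over words behaves like a product
of sums of `a^(-s)`, one factor for each position; the exponent `-2` is the source of the factor 2
in the theorem.

Upper bound for packing: if `ζ_A(s) < ∞`, choose `N` such that the terms of the series with `a ≥ N`
sum to at most `1/2`. The set `F_A` is the countable union over `k` of the sets of sequences with
terms at least `N` from position `k` on. Disjoint balls are cylinders of distinct words, so a
packing sum of exponent `s/2` on such a set is bounded by a series that is eventually geometric
(`tsum_packing_le`, `tsum_prod_range_ne_top`). Larger exponents therefore give packing measure zero.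

Lower bound for Hausdorff: if `ζ_A(s) = ∞`, each position `n` admits a probability measure on `A ∩
[n, ∞)` with weights at most `(a + 2)^(-s)`. The product measure lives on `F_A` and gives a cylinder
at most a constant times `γ(w)^(s/2)`, so the mass distribution principle applies.

The two are linked by `dimH_le_packingDim`: the metric is an ultrametric, so balls of one fixed
radius centred in a set, each counted once, are both a cover and a packing of it. -/

/-! ### Size of the continued fraction cylinders -/

/-- The continuants, shifted by one: `cfDen z (n + 1)` is the denominator `q_n` of the `n`-th
convergent of the continued fraction with partial quotients `z i + 1`. -/
noncomputable def cfDen (z : ℕ → ℕ) : ℕ → ℝ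
  | 0 => 0
  | 1 => 1
  | n + 2 => ((z n : ℝ) + 1) * cfDen z (n + 1) + cfDen z n

theorem cfDen_nonneg_le (z : ℕ → ℕ) (n : ℕ) : 0 ≤ cfDen z n ∧ cfDen z n ≤ cfDen z (n + 1) := by
  induction n with
  | zero => simp [cfDen]
  | succ n ih =>
    have hz : (0 : ℝ) ≤ z n := by positivity
    refine ⟨ih.1.trans ih.2, ?_⟩
    simp only [cfDen]
    nlinarith [mul_nonneg hz (ih.1.trans ih.2)]

theorem prod_le_cfDen (z : ℕ → ℕ) (n : ℕ) :
    ∏ i ∈ Finset.range n, ((z i : ℝ) + 1) ≤ cfDen z (n + 1) := by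
  induction n with
  | zero => simp [cfDen]
  | succ n ih =>
    rw [Finset.prod_range_succ, mul_comm]
    simp only [cfDen]
    have := mul_le_mul_of_nonneg_left ih (show (0 : ℝ) ≤ (z n : ℝ) + 1 by positivity)
    linarith [(cfDen_nonneg_le z n).1]

theorem cfDen_le_prod (z : ℕ → ℕ) (n : ℕ) :
    cfDen z (n + 1) ≤ ∏ i ∈ Finset.range n, ((z i : ℝ) + 2) := by
  induction n with
  | zero => simp [cfDen]
  | succ n ih =>
    rw [Finset.prod_range_succ, mul_comm]
    simp only [cfDen]
    have := mul_le_mul_of_nonneg_left ih (show (0 : ℝ) ≤ (z n : ℝ) + 2 by positivity)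
    linarith [(cfDen_nonneg_le z n).2]

theorem cfDen_succ_pos (z : ℕ → ℕ) (n : ℕ) : 0 < cfDen z (n + 1) :=
  (Finset.prod_pos fun _ _ => by positivity).trans_le (prod_le_cfDen z n)

/-- `cfTail n z` is a Möbius map of determinant `±1` whose denominator is `cfDen z n * x + cfDen z
(n + 1)`. -/
theorem abs_cfTail_sub_eq (z : ℕ → ℕ) (n : ℕ) : ∀ {x y : ℝ}, 0 ≤ x → 0 ≤ y →
    |cfTail n z x - cfTail n z y| =
      |x - y| / ((cfDen z n * x + cfDen z (n + 1)) * (cfDen z n * y + cfDen z (n + 1))) := by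
  induction n with
  | zero => intro x y _ _; simp [cfTail, cfDen]
  | succ n ih =>
    intro x y hx hy
    have hz : (0 : ℝ) ≤ z n := by positivity
    have h0 := (cfDen_nonneg_le z n).1
    have h1 := cfDen_succ_pos z n
    -- `cfTail` unfolds at the outermost digit but `cfDen` recurses on the last one, so the
    -- innermost digit is split off.
    rw [cfTail_add, cfTail_add]
    simp only [cfTail, Nat.zero_add]
    rw [ih (by positivity) (by positivity)]
    simp only [cfDen]
    have hX : 0 < (z n : ℝ) + 1 + x := by positivity
    have hY : 0 < (z n : ℝ) + 1 + y := by positivity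
    have e : 1 / ((z n : ℝ) + 1 + x) - 1 / ((z n : ℝ) + 1 + y)
        = (y - x) / (((z n : ℝ) + 1 + x) * ((z n : ℝ) + 1 + y)) := by
      field_simp; ring
    rw [e, abs_div, abs_of_pos (mul_pos hX hY), abs_sub_comm y x, div_div]
    congr 1
    field_simp
    ring

theorem cfTail_congr {z z' : ℕ → ℕ} {n : ℕ} (h : ∀ i < n, z i = z' i) (x : ℝ) :
    cfTail n z x = cfTail n z' x := by
  induction n generalizing z z' with
  | zero => rfl
  | succ n ih =>
    simp only [cfTail]
    rw [h 0 (by omega), ih fun i hi => h (i + 1) (by omega)]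

theorem cfReal_eq_cfTail (z : ℕ → ℕ) (n : ℕ) :
    cfReal z = cfTail n z (cfReal fun i => z (i + n)) := by
  induction n generalizing z with
  | zero => rfl
  | succ n ih =>
    rw [cfReal_eq, ih]
    simp only [cfTail, Nat.add_assoc]

theorem cfReal_image_cylinder_subset (z : ℕ → ℕ) (n : ℕ) :
    cfReal '' PiNat.cylinder z n ⊆ cfTail n z '' Icc 0 1 := by
  rintro _ ⟨y, hy, rfl⟩
  rw [cfReal_eq_cfTail y n, cfTail_congr hy]
  exact mem_image_of_mem _ (cfReal_mem _)

theorem cfTail_image_irrational_subset (z : ℕ → ℕ) (n : ℕ) :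
    cfTail n z '' (Icc 0 1 ∩ {x | Irrational x}) ⊆ cfReal '' PiNat.cylinder z n := by
  rintro _ ⟨x, ⟨hx, hi⟩, rfl⟩
  obtain ⟨y, rfl⟩ := irrational_mem_range_cfReal hi hx
  let z' : ℕ → ℕ := fun i => if i < n then z i else y (i - n)
  have hz' : z' ∈ PiNat.cylinder z n := fun i hi => by simp [z', hi]
  refine ⟨z', hz', ?_⟩
  rw [cfReal_eq_cfTail z' n, cfTail_congr hz']
  congr
  ext i
  simp [z']

theorem continuousOn_cfTail (z : ℕ → ℕ) (n : ℕ) : ContinuousOn (cfTail n z) (Icc 0 1) := by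
  induction n generalizing z with
  | zero => exact continuousOn_id
  | succ n ih =>
    refine continuousOn_const.div (continuousOn_const.add (ih _)) fun x hx => ?_
    have := (cfTail_mem (n := n) (z := fun i => z (i + 1)) hx).1
    positivity

/-- By the intermediate value theorem `cfTail n z` covers the interval between its values at 0 and
1. Irrational tails are infinite continued fractions, and the rational ones contribute only a
countable set. -/
theorem le_volume_cfReal_image (z : ℕ → ℕ) (n : ℕ) :
    ENNReal.ofReal |cfTail n z 1 - cfTail n z 0| ≤ volume (cfReal '' PiNat.cylinder z n) := by
  have hcount : (Icc (0 : ℝ) 1 ∩ {x : ℝ | Irrational x}ᶜ).Countable := by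
    have : ({x : ℝ | Irrational x}ᶜ) = range ((↑) : ℚ → ℝ) := by
      ext x; simp [Irrational]
    rw [this]
    exact (countable_range _).mono inter_subset_right
  have hsub : uIcc (cfTail n z 0) (cfTail n z 1) ⊆ cfReal '' PiNat.cylinder z n ∪
      cfTail n z '' (Icc (0 : ℝ) 1 ∩ {x : ℝ | Irrational x}ᶜ) := by
    refine (intermediate_value_uIcc (a := (0 : ℝ)) (b := 1) ?_).trans ?_
    · rw [uIcc_of_le zero_le_one]; exact continuousOn_cfTail z n
    · rw [uIcc_of_le zero_le_one]
      rintro _ ⟨x, hx, rfl⟩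
      by_cases hi : Irrational x
      · exact Or.inl (cfTail_image_irrational_subset z n (mem_image_of_mem _ ⟨hx, hi⟩))
      · exact Or.inr (mem_image_of_mem _ ⟨hx, hi⟩)
  rw [← Real.volume_interval]
  refine (measure_mono hsub).trans ((measure_union_le _ _).trans ?_)
  rw [(hcount.image _).measure_zero, add_zero]

theorem volume_cfReal_image_le (z : ℕ → ℕ) (n : ℕ) {c : ℝ}
    (hc : ∀ x ∈ Icc (0 : ℝ) 1, ∀ y ∈ Icc (0 : ℝ) 1, |cfTail n z x - cfTail n z y| ≤ c) :
    volume (cfReal '' PiNat.cylinder z n) ≤ ENNReal.ofReal c := by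
  refine (Real.volume_le_diam _).trans (Metric.ediam_le ?_)
  intro u hu v hv
  obtain ⟨x, hx, rfl⟩ := cfReal_image_cylinder_subset z n hu
  obtain ⟨y, hy, rfl⟩ := cfReal_image_cylinder_subset z n hv
  rw [edist_dist, Real.dist_eq]
  exact ENNReal.ofReal_le_ofReal (hc x hx y hy)

/-- On `[0, 1]` the Gauss density lies between `1 / (2 ln 2) > 1/2` and `1 / ln 2 < 2`; this bound
and the next one follow. -/
theorem gaussMeasure_le {S : Set ℝ} (hS : S ⊆ Icc 0 1) : gaussMeasure S ≤ 2 * volume S := by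
  have h : gaussMeasure ≤ (2 : ℝ≥0∞) • volume.restrict (Icc (0 : ℝ) 1) := by
    rw [← withDensity_const]
    refine withDensity_mono ?_
    filter_upwards [ae_restrict_mem measurableSet_Icc] with t ht
    rw [show (2 : ℝ≥0∞) = ENNReal.ofReal 2 by simp]
    refine ENNReal.ofReal_le_ofReal ?_
    have hl : 1 / 2 < Real.log 2 := by linarith [Real.log_two_gt_d9]
    have ht0 := ht.1
    rw [div_mul_div_comm, one_mul, div_le_iff₀ (by positivity)]
    nlinarith
  have := h S
  rwa [Measure.smul_apply, Measure.restrict_eq_self _ hS] at this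

theorem le_gaussMeasure {S : Set ℝ} (hS : S ⊆ Icc 0 1) :
    ENNReal.ofReal (1 / 2) * volume S ≤ gaussMeasure S := by
  have h : ENNReal.ofReal (1 / 2) • volume.restrict (Icc (0 : ℝ) 1) ≤ gaussMeasure := by
    rw [← withDensity_const]
    refine withDensity_mono ?_
    filter_upwards [ae_restrict_mem measurableSet_Icc] with t ht
    refine ENNReal.ofReal_le_ofReal ?_
    have hl : 0 < Real.log 2 := Real.log_pos one_lt_two
    have hl' : Real.log 2 < 1 := by linarith [Real.log_two_lt_d9]
    have ht0 := ht.1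
    rw [div_mul_div_comm, one_mul]
    refine one_div_le_one_div_of_le (by positivity) ?_
    nlinarith [ht.2]
  have := h S
  rwa [Measure.smul_apply, Measure.restrict_eq_self _ hS] at this

theorem cfReal_image_subset (S : Set (ℕ → ℕ)) : cfReal '' S ⊆ Icc 0 1 := by
  rintro _ ⟨y, -, rfl⟩
  exact cfReal_mem y

theorem gaussCyl_le_of_abs_sub_le (z : ℕ → ℕ) (n : ℕ) {c : ℝ}
    (hc : ∀ x ∈ Icc (0 : ℝ) 1, ∀ y ∈ Icc (0 : ℝ) 1, |cfTail n z x - cfTail n z y| ≤ c) :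
    gaussCyl z n ≤ 2 * ENNReal.ofReal c :=
  (gaussMeasure_le (cfReal_image_subset _)).trans (by gcongr; exact volume_cfReal_image_le z n hc)

theorem tendsto_gaussCyl (z : ℕ → ℕ) : Tendsto (gaussCyl z) atTop (𝓝 0) := by
  have h1 := tendsto_pow_atTop_nhds_zero_of_lt_one (r := (1 / 2 : ℝ)) (by norm_num) (by norm_num)
  have h2 := ENNReal.Tendsto.const_mul (a := 2) (ENNReal.tendsto_ofReal (h1.const_mul 2))
    (Or.inr (by simp))
  simp only [mul_zero, ENNReal.ofReal_zero] at h2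
  exact tendsto_of_tendsto_of_tendsto_of_le_of_le tendsto_const_nhds h2 (fun _ => zero_le)
    fun n => gaussCyl_le_of_abs_sub_le z n fun x hx y hy => abs_cfTail_sub_le n z hx hy

theorem prod_natCast_add_rpow (z : ℕ → ℕ) (n k : ℕ) (r : ℝ) :
    ∏ i ∈ Finset.range n, ((z i : ℝ≥0∞) + k) ^ r =
      ENNReal.ofReal (∏ i ∈ Finset.range n, ((z i : ℝ) + k)) ^ r := by
  rw [ENNReal.ofReal_prod_of_nonneg fun i _ => by positivity,
    ← ENNReal.prod_rpow_of_ne_top fun i _ => ENNReal.ofReal_ne_top]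
  refine Finset.prod_congr rfl fun i _ => ?_
  rw [ENNReal.ofReal_add (by positivity) (by positivity), ENNReal.ofReal_natCast,
    ENNReal.ofReal_natCast]

theorem gaussCyl_le_prod (z : ℕ → ℕ) (n : ℕ) :
    gaussCyl z n ≤ 2 * ∏ i ∈ Finset.range n, ((z i : ℝ≥0∞) + 1) ^ (-2 : ℝ) := by
  have hprod := prod_natCast_add_rpow z n 1 (-2)
  simp only [Nat.cast_one] at hprod
  have hpos : 0 < ∏ i ∈ Finset.range n, ((z i : ℝ) + 1) :=
    Finset.prod_pos fun i _ => by positivity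
  rw [hprod, ENNReal.ofReal_rpow_of_pos hpos]
  refine gaussCyl_le_of_abs_sub_le z n fun x hx y hy => ?_
  have h0 := (cfDen_nonneg_le z n).1
  have h1 := prod_le_cfDen z n
  rw [abs_cfTail_sub_eq z n hx.1 hy.1, Real.rpow_neg hpos.le, Real.rpow_two, ← one_div]
  have hx0 := mul_nonneg h0 hx.1
  have hy0 := mul_nonneg h0 hy.1
  refine div_le_div₀ zero_le_one ?_ (by positivity) ?_
  · rw [abs_le]; constructor <;> linarith [hx.1, hx.2, hy.1, hy.2]
  · rw [sq]
    exact mul_le_mul (by linarith) (by linarith) hpos.le (by linarith)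

/-- One factor 2 comes from `q_{n-1} + q_n ≤ 2 q_n` in the length of the cylinder, the other from
the lower bound `1/2` for the density. -/
theorem prod_le_gaussCyl (z : ℕ → ℕ) (n : ℕ) :
    ∏ i ∈ Finset.range n, ((z i : ℝ≥0∞) + 2) ^ (-2 : ℝ) ≤ 4 * gaussCyl z n := by
  have hprod := prod_natCast_add_rpow z n 2 (-2)
  simp only [Nat.cast_ofNat] at hprod
  have hpos : 0 < ∏ i ∈ Finset.range n, ((z i : ℝ) + 2) :=
    Finset.prod_pos fun i _ => by positivity
  have h0 := cfDen_nonneg_le z n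
  have h1 := cfDen_le_prod z n
  have hq := cfDen_succ_pos z n
  have hr : (∏ i ∈ Finset.range n, ((z i : ℝ) + 2)) ^ (-2 : ℝ) ≤
      2 * |cfTail n z 1 - cfTail n z 0| := by
    rw [abs_cfTail_sub_eq z n zero_le_one le_rfl, Real.rpow_neg hpos.le, Real.rpow_two,
      ← one_div, sub_zero, abs_one, mul_one, mul_zero, zero_add, mul_one_div,
      div_le_div_iff₀ (by positivity) (mul_pos (by linarith) hq)]
    nlinarith
  have h4 : (4 : ℝ≥0∞) * ENNReal.ofReal (1 / 2) = ENNReal.ofReal 2 := by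
    rw [show (4 : ℝ≥0∞) = ENNReal.ofReal 4 by simp, ← ENNReal.ofReal_mul (by norm_num)]
    norm_num
  rw [hprod, ENNReal.ofReal_rpow_of_pos hpos]
  calc _ ≤ ENNReal.ofReal (2 * |cfTail n z 1 - cfTail n z 0|) := ENNReal.ofReal_le_ofReal hr
    _ = 4 * (ENNReal.ofReal (1 / 2) * ENNReal.ofReal |cfTail n z 1 - cfTail n z 0|) := by
      rw [ENNReal.ofReal_mul zero_le_two, ← mul_assoc, h4]
    _ ≤ 4 * gaussCyl z n := by
      gcongr
      refine le_trans ?_ (le_gaussMeasure (cfReal_image_subset _))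
      gcongr
      exact le_volume_cfReal_image z n

/-! ### The metric of `GaussBaire` -/

namespace GaussBaire

theorem gaussCyl_ne_top (z : ℕ → ℕ) (n : ℕ) : gaussCyl z n ≠ ∞ := (gaussMeasure_lt_top _).ne

theorem edist_of_ne {x y : GaussBaire} (h : x ≠ y) :
    edist x y = gaussCyl x.seq (PiNat.firstDiff x.seq y.seq) := by
  have h' : x.seq ≠ y.seq := fun e => h (GaussBaire.ext e)
  rw [edist_dist]
  change ENNReal.ofReal (gaussDist x.seq y.seq) = _
  rw [gaussDist, if_neg h', ENNReal.ofReal_toReal (gaussCyl_ne_top _ _)]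

theorem edist_le_of_mem_cylinder {x y : GaussBaire} {n : ℕ}
    (h : y.seq ∈ PiNat.cylinder x.seq n) : edist x y ≤ gaussCyl x.seq n := by
  by_cases hxy : x = y
  · simp [hxy]
  · have h' : x.seq ≠ y.seq := fun e => hxy (GaussBaire.ext e)
    rw [edist_of_ne hxy]
    refine gaussCyl_anti _ ?_
    rw [PiNat.mem_cylinder_comm] at h
    exact (PiNat.mem_cylinder_iff_le_firstDiff h' n).1 h

/-- The strict inequality yields agreement at index `n` too, hence on `n + 1` terms; the mass
distribution principle needs this extra term. -/
theorem mem_cylinder_of_edist_lt {x y : GaussBaire} {n : ℕ} (h : edist x y < gaussCyl x.seq n) :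
    ∀ i ≤ n, y.seq i = x.seq i := by
  intro i hi
  by_cases hxy : x = y
  · rw [hxy]
  rw [edist_of_ne hxy] at h
  have : n < PiNat.firstDiff x.seq y.seq := by
    by_contra! hle
    exact h.not_ge (gaussCyl_anti _ hle)
  exact (PiNat.apply_eq_of_lt_firstDiff (hi.trans_lt this)).symm

instance instIsUltrametricDist : IsUltrametricDist GaussBaire := by
  refine ⟨fun x y z => ?_⟩
  by_cases hxz : x = z
  · rw [hxz, dist_self]
    exact dist_nonneg.trans (le_max_left _ _)
  by_cases hxy : x = y
  · rw [hxy]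
    exact le_max_right _ _
  by_cases hyz : y = z
  · rw [hyz]
    exact le_max_left _ _
  have hxz' : x.seq ≠ z.seq := fun e => hxz (GaussBaire.ext e)
  rw [← ENNReal.ofReal_le_ofReal_iff (dist_nonneg.trans (le_max_left _ _)), ENNReal.ofReal_max,
    ← edist_dist, ← edist_dist, ← edist_dist, le_max_iff]
  rcases min_le_iff.1 (PiNat.min_firstDiff_le x.seq y.seq z.seq hxz') with h | h
  · left
    rw [edist_of_ne hxz, edist_of_ne hxy]
    exact gaussCyl_anti _ h
  · right
    rw [edist_comm x z, edist_comm y z, edist_of_ne (Ne.symm hxz), edist_of_ne (Ne.symm hyz),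
      PiNat.firstDiff_comm z.seq x.seq, PiNat.firstDiff_comm z.seq y.seq]
    exact gaussCyl_anti _ h

theorem continuous_mk : Continuous GaussBaire.mk := by
  rw [continuous_iff_continuousAt]
  intro z
  refine EMetric.tendsto_nhds.2 fun ε hε => ?_
  obtain ⟨n, hn⟩ := ((tendsto_gaussCyl z).eventually (gt_mem_nhds hε)).exists
  filter_upwards [(PiNat.isOpen_cylinder (fun _ => ℕ) z n).mem_nhds
    (PiNat.self_mem_cylinder z n)] with y hy
  rw [edist_comm]
  exact (edist_le_of_mem_cylinder (x := ⟨z⟩) (y := ⟨y⟩) hy).trans_lt hn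

theorem continuous_seq : Continuous GaussBaire.seq := by
  rw [continuous_pi_iff]
  intro i
  rw [continuous_iff_continuousAt]
  intro x
  refine tendsto_nhds_of_eventually_eq ?_
  filter_upwards [Metric.eball_mem_nhds x (pos_iff_ne_zero.2 (gaussCyl_pos x.seq i))] with y hy
  rw [Metric.mem_eball, edist_comm] at hy
  exact mem_cylinder_of_edist_lt hy i le_rfl

/-- `GaussBaire` is homeomorphic to the Baire space with its product topology. -/
noncomputable def homeomorph : (ℕ → ℕ) ≃ₜ GaussBaire where
  toFun := GaussBaire.mk
  invFun := GaussBaire.seq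
  left_inv _ := rfl
  right_inv _ := rfl
  continuous_toFun := continuous_mk
  continuous_invFun := continuous_seq

instance instSeparableSpace : TopologicalSpace.SeparableSpace GaussBaire :=
  homeomorph.surjective.denseRange.separableSpace homeomorph.continuous

theorem ediam_cylinder_le (z : ℕ → ℕ) (n : ℕ) :
    Metric.ediam (GaussBaire.seq ⁻¹' PiNat.cylinder z n) ≤ gaussCyl z n := by
  refine Metric.ediam_le fun y hy w hw => ?_
  have hy' := PiNat.mem_cylinder_iff_eq.1 hy
  have hw' : w.seq ∈ PiNat.cylinder y.seq n := by rw [hy']; exact hw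
  refine (edist_le_of_mem_cylinder hw').trans_eq ?_
  rw [gaussCyl, hy', gaussCyl]

/-- Distances from `x` take only the values 0 and `gaussCyl x.seq n`, which decrease to 0 in `n`;
the least `n` with value at most `r` determines the ball. -/
theorem exists_closedBall_eq_cylinder (x : GaussBaire) {r : ℝ} (hr : 0 < r) :
    ∃ n, Metric.closedBall x r = GaussBaire.seq ⁻¹' PiNat.cylinder x.seq n := by
  classical
  have h : ∃ n, gaussCyl x.seq n ≤ ENNReal.ofReal r :=
    ((tendsto_gaussCyl x.seq).eventually (ge_mem_nhds (ENNReal.ofReal_pos.2 hr))).exists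
  refine ⟨Nat.find h, ?_⟩
  ext y
  rw [mem_preimage, Metric.mem_closedBall, ← edist_le_ofReal hr.le, edist_comm]
  constructor
  · intro hy
    by_cases hxy : y = x
    · rw [hxy]
      exact PiNat.self_mem_cylinder _ _
    have h' : y.seq ≠ x.seq := fun e => hxy (GaussBaire.ext e)
    rw [edist_of_ne (Ne.symm hxy)] at hy
    rw [PiNat.mem_cylinder_iff_le_firstDiff h', PiNat.firstDiff_comm]
    exact Nat.find_min' h hy
  · intro hy
    exact (edist_le_of_mem_cylinder hy).trans (Nat.find_spec h)

end GaussBaire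

/-! ### Hausdorff dimension and packing dimension of ultrametric spaces -/

section Ultrametric

variable {X : Type*} [MetricSpace X] [IsUltrametricDist X]

theorem ediam_closedBall_le_of_ultrametric (x : X) (r : ℝ) :
    Metric.ediam (Metric.closedBall x r) ≤ ENNReal.ofReal r := by
  refine Metric.ediam_le fun y hy z hz => ?_
  rw [edist_dist]
  refine ENNReal.ofReal_le_ofReal ?_
  rw [IsUltrametricDist.closedBall_eq_of_mem hy] at hz
  rw [dist_comm]
  exact hz

/-- The balls of a given radius centred in `E` partition `E`, and form a packing. -/
theorem exists_isBallPacking_covering [TopologicalSpace.SeparableSpace X] (E : Set X) {δ : ℝ}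
    (hδ : 0 < δ) : ∃ P : Set (X × ℝ), IsBallPacking δ E P ∧ (∀ b ∈ P, b.2 = δ) ∧
      E ⊆ ⋃ b : P, Metric.closedBall (b : X × ℝ).1 (b : X × ℝ).2 := by
  have hne : ∀ x : E, (Metric.closedBall (x : X) δ ∩ E).Nonempty := fun x =>
    ⟨x, Metric.mem_closedBall_self hδ.le, x.2⟩
  -- A packing consists of centre-radius pairs, so each ball needs a single chosen centre in `E`;
  -- the same ball under two centres would break disjointness.
  choose g hg using fun S : {S : Set X // (S ∩ E).Nonempty} => S.2
  have hball : ∀ x : E, Metric.closedBall (g ⟨_, hne x⟩) δ = Metric.closedBall (x : X) δ :=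
    fun x => (IsUltrametricDist.closedBall_eq_of_mem (hg ⟨_, hne x⟩).1).symm
  let P : Set (X × ℝ) := range fun x : E => (g ⟨_, hne x⟩, δ)
  have hdisj : P.PairwiseDisjoint fun b => Metric.closedBall b.1 b.2 := by
    rintro _ ⟨x, rfl⟩ _ ⟨y, rfl⟩ hxy
    simp only [Function.onFun, hball]
    refine (IsUltrametricDist.closedBall_eq_or_disjoint (x : X) (y : X) δ).resolve_left fun h => ?_
    exact hxy (by simp only [h])
  refine ⟨P, ⟨?_, ?_, hdisj⟩, ?_, fun x hx => ?_⟩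
  · refine hdisj.countable_of_isOpen ?_ ?_
    · rintro _ ⟨x, rfl⟩
      exact IsUltrametricDist.isOpen_closedBall _ hδ.ne'
    · rintro _ ⟨x, rfl⟩
      exact ⟨_, Metric.mem_closedBall_self hδ.le⟩
  · rintro _ ⟨x, rfl⟩
    exact ⟨(hg ⟨_, hne x⟩).2, hδ, le_rfl⟩
  · rintro _ ⟨x, rfl⟩
    rfl
  · refine mem_iUnion.2 ⟨⟨_, ⟨x, hx⟩, rfl⟩, ?_⟩
    change x ∈ Metric.closedBall (g ⟨_, hne ⟨x, hx⟩⟩) δ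
    rw [hball]
    exact Metric.mem_closedBall_self hδ.le

/-- The covers of radius `δ / (n + 1)` are fine enough to compute the Hausdorff measure, and each of
them is a `δ`-packing. -/
theorem hausdorffMeasure_le_packingPre [TopologicalSpace.SeparableSpace X] [MeasurableSpace X]
    [BorelSpace X] (s : ℝ≥0) (E : Set X) :
    Measure.hausdorffMeasure (s : ℝ) E ≤ packingPre s E := by
  refine le_iInf₂ fun δ hδ => ?_
  have hδn : ∀ n : ℕ, 0 < δ / (n + 1) := fun n => by positivity
  choose P hP hPδ hPE using fun n : ℕ => exists_isBallPacking_covering E (hδn n)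
  have : ∀ n, Countable (P n) := fun n => (hP n).1
  have hr : Tendsto (fun n : ℕ => ENNReal.ofReal (δ / (n + 1))) atTop (𝓝 0) := by
    have := ENNReal.tendsto_ofReal (tendsto_const_div_atTop_nhds_zero_nat δ)
    rw [ENNReal.ofReal_zero] at this
    simpa [Function.comp_def] using this.comp (tendsto_add_atTop_nat 1)
  refine (Measure.hausdorffMeasure_le_liminf_tsum (ι := fun n => P n) (s : ℝ) E _ hr
    (fun n b => Metric.closedBall (b : X × ℝ).1 (b : X × ℝ).2) ?_
    (Eventually.of_forall hPE)).trans ?_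
  · refine Eventually.of_forall fun n b => ?_
    rw [hPδ n b b.2]
    exact ediam_closedBall_le_of_ultrametric _ _
  · refine liminf_le_of_le (by isBoundedDefault) fun c hc => ?_
    obtain ⟨n, hn⟩ := hc.exists
    refine hn.trans (le_iSup₂_of_le (P n) ⟨(hP n).1, fun b hb => ?_, (hP n).2.2⟩ le_rfl)
    obtain ⟨h1, h2, h3⟩ := (hP n).2.1 b hb
    refine ⟨h1, h2, h3.trans (div_le_self hδ.le ?_)⟩
    have : (0 : ℝ) ≤ n := by positivity
    linarith

theorem hausdorffMeasure_le_packingMeas [TopologicalSpace.SeparableSpace X] [MeasurableSpace X]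
    [BorelSpace X] (s : ℝ≥0) (E : Set X) :
    Measure.hausdorffMeasure (s : ℝ) E ≤ packingMeas s E :=
  le_iInf₂ fun U hU => (measure_mono hU).trans <| (measure_iUnion_le U).trans <|
    ENNReal.tsum_le_tsum fun i => hausdorffMeasure_le_packingPre s (U i)

theorem dimH_le_packingDim [TopologicalSpace.SeparableSpace X] (E : Set X) :
    dimH E ≤ packingDim E := by
  borelize X
  refine dimH_le fun d hd => le_iSup₂_of_le d ?_ le_rfl
  exact top_le_iff.1 (hd.symm.trans_le (hausdorffMeasure_le_packingMeas d E))

end Ultrametric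

/-! ### The upper bound for the packing dimension -/

theorem tsum_pi_prod_eq {α : Type*} (g : ℕ → α → ℝ≥0∞) (n : ℕ) :
    ∑' u : Fin n → α, ∏ i : Fin n, g i (u i) = ∏ i ∈ Finset.range n, ∑' a, g i a := by
  induction n with
  | zero => simp
  | succ n ih =>
    rw [← (Fin.snocEquiv fun _ : Fin (n + 1) => α).tsum_eq, ENNReal.tsum_prod',
      Finset.prod_range_succ, ← ih, mul_comm, ← ENNReal.tsum_mul_right]
    refine tsum_congr fun a => ?_
    rw [← ENNReal.tsum_mul_left]
    refine tsum_congr fun u => ?_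
    simp [Fin.prod_univ_castSucc, Fin.snocEquiv, mul_comm]

/-- The sequences with values in `A` all of whose terms from the `k`-th on are at least `N`. -/
def tailSet (A : Set ℕ+) (N k : ℕ) : Set GaussBaire :=
  {f | (∀ n, f.seq n ∈ ((↑) : ℕ+ → ℕ) '' A) ∧ ∀ n, k ≤ n → N ≤ f.seq n}

theorem escapingSet_subset_iUnion_tailSet (A : Set ℕ+) (N : ℕ) :
    escapingSet A ⊆ ⋃ k, tailSet A N k := by
  rintro f ⟨hfA, hf⟩
  obtain ⟨k, hk⟩ := eventually_atTop.1 (hf.eventually_ge_atTop N)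
  exact mem_iUnion.2 ⟨k, hfA, hk⟩

theorem tsum_packing_le (s : ℝ≥0) (B : ℕ → Set ℕ) {δ : ℝ} {P : Set (GaussBaire × ℝ)}
    (hP : IsBallPacking δ {f | ∀ n, f.seq n ∈ B n} P) :
    ∑' b : P, Metric.ediam (Metric.closedBall (b : GaussBaire × ℝ).1 (b : GaussBaire × ℝ).2) ^
      (s : ℝ) ≤ ∑' n, (2 : ℝ≥0∞) ^ (s : ℝ) * ∏ i ∈ Finset.range n,
        ∑' a, (B i).indicator (fun a : ℕ => ((a : ℝ≥0∞) + 1) ^ (-2 * (s : ℝ))) a := by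
  classical
  set g : ℕ → ℕ → ℝ≥0∞ := fun i => (B i).indicator fun a : ℕ => ((a : ℝ≥0∞) + 1) ^ (-2 * (s : ℝ))
  choose n hn using fun b : P => GaussBaire.exists_closedBall_eq_cylinder
    (b : GaussBaire × ℝ).1 (hP.2.1 b b.2).2.1
  -- Each ball is encoded by its word. Equal words would give equal balls, so the packing sum is
  -- dominated by the sum over all finite words, which factors position by position.
  let w : P → Σ n, (Fin n → ℕ) := fun b => ⟨n b, fun i => (b : GaussBaire × ℝ).1.seq i⟩
  have hw : Function.Injective w := by
    intro b c hbc
    by_contra hne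
    have hd := hP.2.2 b.2 c.2 fun e => hne (Subtype.ext e)
    have hcyl : ∀ (m k : ℕ) (y z : ℕ → ℕ), (⟨m, fun i => y i⟩ : Σ n, (Fin n → ℕ)) =
        ⟨k, fun i => z i⟩ → PiNat.cylinder y m = PiNat.cylinder z k := by
      intro m k y z h
      obtain ⟨rfl, h⟩ := Sigma.mk.inj h
      rw [← PiNat.mem_cylinder_iff_eq]
      exact fun i hi => congrFun (eq_of_heq h) ⟨i, hi⟩
    simp only [Function.onFun, hn, hcyl _ _ _ _ hbc, disjoint_self] at hd
    have : (c : GaussBaire × ℝ).1 ∈ (∅ : Set GaussBaire) := by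
      rw [← Set.bot_eq_empty, ← hd]
      exact PiNat.self_mem_cylinder _ _
    exact this
  have hterm : ∀ b : P, Metric.ediam (Metric.closedBall (b : GaussBaire × ℝ).1
      (b : GaussBaire × ℝ).2) ^ (s : ℝ) ≤ (2 : ℝ≥0∞) ^ (s : ℝ) * ∏ i : Fin (w b).1, g i ((w b).2 i) := by
    intro b
    have hb := (hP.2.1 b b.2).1
    rw [hn]
    refine (ENNReal.rpow_le_rpow ((GaussBaire.ediam_cylinder_le _ _).trans
      (gaussCyl_le_prod _ _)) s.coe_nonneg).trans_eq ?_
    rw [ENNReal.mul_rpow_of_nonneg _ _ s.coe_nonneg, ← ENNReal.prod_rpow_of_nonneg s.coe_nonneg,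
      Finset.prod_range]
    congr 1
    refine Finset.prod_congr rfl fun i _ => ?_
    simp only [g, w, indicator_of_mem (hb i), ENNReal.rpow_mul]
  calc _ ≤ ∑' b : P, (fun u : Σ n, (Fin n → ℕ) => (2 : ℝ≥0∞) ^ (s : ℝ) * ∏ i : Fin u.1, g i (u.2 i)) (w b) :=
        ENNReal.tsum_le_tsum hterm
    _ ≤ ∑' u : Σ n, (Fin n → ℕ), (2 : ℝ≥0∞) ^ (s : ℝ) * ∏ i : Fin u.1, g i (u.2 i) :=
        ENNReal.tsum_comp_le_tsum_of_injective hw _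
    _ = _ := by
        rw [ENNReal.tsum_sigma']
        refine tsum_congr fun n => ?_
        rw [ENNReal.tsum_mul_left, tsum_pi_prod_eq]

theorem tsum_prod_range_ne_top {S : ℕ → ℝ≥0∞} {k : ℕ} (hS : ∀ i, S i ≠ ∞)
    (hk : ∀ i, k ≤ i → S i ≤ 1 / 2) : ∑' n, ∏ i ∈ Finset.range n, S i ≠ ∞ := by
  rw [← Summable.sum_add_tsum_nat_add' (f := fun n => ∏ i ∈ Finset.range n, S i) (k := k)
    ENNReal.summable, ENNReal.add_ne_top]
  refine ⟨ENNReal.sum_ne_top.2 fun n _ => ENNReal.prod_ne_top fun i _ => hS i, ?_⟩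
  refine ne_top_of_le_ne_top (b := (∏ i ∈ Finset.range k, S i) * ∑' n : ℕ, (1 / 2 : ℝ≥0∞) ^ n) ?_ ?_
  · refine ENNReal.mul_ne_top (ENNReal.prod_ne_top fun i _ => hS i) ?_
    simp [ENNReal.tsum_geometric]
  · rw [← ENNReal.tsum_mul_left]
    refine ENNReal.tsum_le_tsum fun n => ?_
    rw [add_comm, Finset.prod_range_add]
    gcongr
    refine (Finset.prod_le_prod' fun i _ => hk (k + i) (by omega)).trans_eq ?_
    simp

/-- For balls of radius at most `ε`, `diam^t ≤ ε^(t-s) * diam^s`, and the first factor tends to 0.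
-/
theorem packingPre_eq_zero_of_lt {X : Type*} [MetricSpace X] [IsUltrametricDist X] {s t : ℝ≥0}
    (hst : s < t) {E : Set X} {δ : ℝ} (hδ : 0 < δ) (h : packingPreAt s δ E ≠ ∞) : packingPre t E = 0 := by
  have hst' : 0 < (t : ℝ) - s := sub_pos.2 hst
  have hle : ∀ ε : ℝ, 0 < ε → ε ≤ δ →
      packingPre t E ≤ ENNReal.ofReal ε ^ ((t : ℝ) - s) * packingPreAt s δ E := by
    intro ε hε hεδ
    refine (iInf₂_le ε hε).trans (iSup₂_le fun P hP => ?_)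
    have hP' : IsBallPacking δ E P :=
      ⟨hP.1, fun b hb => ⟨(hP.2.1 b hb).1, (hP.2.1 b hb).2.1, (hP.2.1 b hb).2.2.trans hεδ⟩, hP.2.2⟩
    refine le_trans ?_ (mul_le_mul_right (le_iSup₂_of_le P hP' le_rfl) _)
    rw [← ENNReal.tsum_mul_left]
    refine ENNReal.tsum_le_tsum fun b => ?_
    have hd : Metric.ediam (Metric.closedBall (b : X × ℝ).1 (b : X × ℝ).2) ≤ ENNReal.ofReal ε :=
      (ediam_closedBall_le_of_ultrametric _ _).trans
        (ENNReal.ofReal_le_ofReal (hP.2.1 b b.2).2.2)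
    calc _ = Metric.ediam (Metric.closedBall (b : X × ℝ).1 (b : X × ℝ).2) ^
          (((t : ℝ) - s) + s) := by rw [sub_add_cancel]
      _ = _ := ENNReal.rpow_add_of_nonneg _ _ hst'.le s.coe_nonneg
      _ ≤ _ := by gcongr
  have hlim : Tendsto (fun ε : ℝ => ENNReal.ofReal ε ^ ((t : ℝ) - s) * packingPreAt s δ E)
      (𝓝[>] 0) (𝓝 0) := by
    have h1 : Tendsto (fun ε : ℝ => ENNReal.ofReal ε ^ ((t : ℝ) - s)) (𝓝 0) (𝓝 0) := by
      have := ((ENNReal.continuous_rpow_const (y := (t : ℝ) - s)).comp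
        ENNReal.continuous_ofReal).tendsto 0
      simpa [ENNReal.zero_rpow_of_pos hst', Function.comp_def] using this
    have := ENNReal.Tendsto.mul_const (h1.mono_left (nhdsWithin_le_nhds (s := Ioi 0))) (Or.inr h)
    rwa [zero_mul] at this
  refine le_antisymm (ge_of_tendsto hlim ?_) zero_le
  filter_upwards [Ioc_mem_nhdsGT hδ] with ε hε using hle ε hε.1 hε.2

theorem zetaSum_eq_tsum_indicator (A : Set ℕ+) (s : ℝ≥0) :
    zetaSum A s = ∑' a, (((↑) : ℕ+ → ℕ) '' A).indicator (fun a : ℕ => (a : ℝ≥0∞) ^ (-(s : ℝ))) a := by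
  rw [← tsum_subtype, tsum_image (f := fun a : ℕ => (a : ℝ≥0∞) ^ (-(s : ℝ)))
    PNat.coe_injective.injOn]
  rfl

theorem packingMeas_escapingSet_eq_zero {A : Set ℕ+} {s t : ℝ≥0} (hs : zetaSum A s ≠ ∞)
    (hst : s < 2 * t) : packingMeas t (escapingSet A) = 0 := by
  set I : Set ℕ := ((↑) : ℕ+ → ℕ) '' A
  set h : ℕ → ℝ≥0∞ := I.indicator fun a : ℕ => (a : ℝ≥0∞) ^ (-(s : ℝ))
  rw [zetaSum_eq_tsum_indicator] at hs
  obtain ⟨N, hN⟩ := ((ENNReal.tendsto_sum_nat_add h hs).eventually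
    (ge_mem_nhds (show (0 : ℝ≥0∞) < 1 / 2 by simp))).exists
  have hst' : s / 2 < t := by
    rw [div_lt_iff₀ two_pos]; rwa [mul_comm] at hst
  have hpre : ∀ k, packingPre t (tailSet A N k) = 0 := by
    intro k
    -- Positions before `k` contribute a finite factor at most `ζ_A(s)`, and later ones a factor at
    -- most `1/2`.
    let B : ℕ → Set ℕ := fun i => {a | a ∈ I ∧ (k ≤ i → N ≤ a)}
    have hB : tailSet A N k = {f | ∀ n, f.seq n ∈ B n} := by
      ext f
      simp only [tailSet, B, mem_ofPred_eq, forall_and]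
      rfl
    have hle : ∀ i a, (B i).indicator (fun a : ℕ => ((a : ℝ≥0∞) + 1) ^
        (-2 * ((s / 2 : ℝ≥0) : ℝ))) a ≤ h a := by
      intro i a
      simp only [h]
      by_cases ha : a ∈ B i
      · rw [indicator_of_mem ha, indicator_of_mem ha.1]
        have he : -2 * ((s / 2 : ℝ≥0) : ℝ) = -(s : ℝ) := by push_cast; ring
        rw [he, ENNReal.rpow_neg, ENNReal.rpow_neg, ENNReal.inv_le_inv]
        exact ENNReal.rpow_le_rpow le_self_add s.coe_nonneg
      · rw [indicator_of_notMem ha]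
        exact zero_le
    rw [hB]
    refine packingPre_eq_zero_of_lt hst' one_pos
      (ne_top_of_le_ne_top ?_ (iSup₂_le fun P hP => tsum_packing_le (s / 2) B hP))
    rw [ENNReal.tsum_mul_left]
    refine ENNReal.mul_ne_top (ENNReal.rpow_ne_top_of_nonneg (s / 2).2 (by simp))
      (tsum_prod_range_ne_top (k := k) (fun i => ?_) fun i hi => ?_)
    · exact ne_top_of_le_ne_top hs (ENNReal.tsum_le_tsum (hle i))
    · refine le_trans ?_ hN
      rw [← Summable.sum_add_tsum_nat_add' (k := N) ENNReal.summable, Finset.sum_eq_zero, zero_add]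
      · exact ENNReal.tsum_le_tsum fun a => hle i (a + N)
      · intro a ha
        refine indicator_of_notMem (fun haB => ?_) _
        exact (haB.2 hi).not_gt (Finset.mem_range.1 ha)
  refine le_antisymm ((iInf₂_le (tailSet A N) (escapingSet_subset_iUnion_tailSet A N)).trans ?_) zero_le
  simp [hpre]

theorem two_mul_packingDim_escapingSet_le (A : Set ℕ+) :
    2 * packingDim (escapingSet A) ≤ zetaDim A := by
  refine le_iInf₂ fun s hs => ?_
  rw [packingDim, ENNReal.mul_iSup]
  refine iSup_le fun t => ?_
  rw [ENNReal.mul_iSup]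
  refine iSup_le fun ht => ?_
  by_contra! hlt
  have hlt' : s < 2 * t := by exact_mod_cast hlt
  rw [packingMeas_escapingSet_eq_zero hs.ne hlt'] at ht
  simp at ht

/-! ### The lower bound for the Hausdorff dimension -/

/-- Mass distribution principle: a set charged by a measure that is bounded by a multiple of
`gaussCyl ^ s` on cylinders has positive `s`-dimensional Hausdorff measure. -/
theorem GaussBaire.hausdorffMeasure_ne_zero_of_cylinder_le [MeasurableSpace GaussBaire]
    [BorelSpace GaussBaire] {s : ℝ} (hs : 0 < s) {μ : Measure (ℕ → ℕ)} {c : ℝ≥0∞} (hc0 : c ≠ 0)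
    (hμ : ∀ z n, c * μ (PiNat.cylinder z n) ≤ gaussCyl z n ^ s) {E : Set GaussBaire}
    (hE : μ (GaussBaire.mk ⁻¹' E) ≠ 0) : Measure.hausdorffMeasure s E ≠ 0 := by
  let ν : Measure GaussBaire := c • μ.map homeomorph.toMeasurableEquiv
  have hν : ∀ S, ν S = c * μ (GaussBaire.mk ⁻¹' S) := fun S => by
    rw [Measure.smul_apply, MeasurableEquiv.map_apply, smul_eq_mul]
    rfl
  have hle : ν ≤ Measure.hausdorffMeasure s := by
    refine Measure.le_hausdorffMeasure s ν 1 one_pos fun S _ => ?_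
    rcases S.eq_empty_or_nonempty with rfl | ⟨x, hx⟩
    · simp
    have hcyl : ∀ n, GaussBaire.mk ⁻¹' S ⊆ PiNat.cylinder x.seq n → ν S ≤ gaussCyl x.seq n ^ s :=
      fun n hn => (hν S).trans_le ((mul_le_mul_right (measure_mono hn) c).trans (hμ _ _))
    -- Either `S` lies in every cylinder around `x` and has mass 0, or there is a longest cylinder
    -- containing it, whose `gaussCyl` is at most the diameter of `S`.
    by_cases hS : ∀ n, GaussBaire.mk ⁻¹' S ⊆ PiNat.cylinder x.seq n
    · have hlim : Tendsto (fun n => gaussCyl x.seq n ^ s) atTop (𝓝 0) := by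
        have := ((ENNReal.continuous_rpow_const (y := s)).tendsto 0).comp (tendsto_gaussCyl x.seq)
        simpa [ENNReal.zero_rpow_of_pos hs, Function.comp_def] using this
      exact (ge_of_tendsto hlim (Eventually.of_forall fun n => hcyl n (hS n))).trans zero_le
    · classical
      push Not at hS
      have h0 : Nat.find hS ≠ 0 := by
        intro h0
        have := Nat.find_spec hS
        simp [h0] at this
      obtain ⟨n, hn⟩ := Nat.exists_eq_succ_of_ne_zero h0
      have hn1 : GaussBaire.mk ⁻¹' S ⊆ PiNat.cylinder x.seq n := by
        by_contra h
        have := Nat.find_min' hS h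
        omega
      obtain ⟨y, hyS, hy⟩ := not_subset.1 (hn ▸ Nat.find_spec hS)
      refine (hcyl n hn1).trans (ENNReal.rpow_le_rpow ?_ hs.le)
      refine le_trans ?_ (Metric.edist_le_ediam_of_mem hx hyS)
      by_contra! hlt
      exact hy fun i hi => mem_cylinder_of_edist_lt hlt i (Nat.lt_succ_iff.1 hi)
  intro h
  have := (hle E).trans_eq h
  rw [hν, nonpos_iff_eq_zero, mul_eq_zero] at this
  exact this.elim hc0 hE

/-- If `∑_{n ∈ A} n^{-s}` diverges, there are probability measures on `A` supported far out, with
`p a ≤ (a + 2)^{-s}`. -/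
theorem exists_pmf_of_zetaSum_eq_top {A : Set ℕ+} {s : ℝ≥0} (hA : zetaSum A s = ∞) (m : ℕ) :
    ∃ p : PMF ℕ, (∀ a, p a ≤ ((a : ℝ≥0∞) + 2) ^ (-(s : ℝ))) ∧
      p.support ⊆ {a | a ∈ ((↑) : ℕ+ → ℕ) '' A ∧ m ≤ a} := by
  set I : Set ℕ := ((↑) : ℕ+ → ℕ) '' A
  rw [zetaSum_eq_tsum_indicator] at hA
  set h : ℕ → ℝ≥0∞ := I.indicator fun a : ℕ => (a : ℝ≥0∞) ^ (-(s : ℝ))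
  have hI : ∀ a ∈ I, 1 ≤ a := by
    rintro _ ⟨a, -, rfl⟩
    exact a.2
  have hh : ∀ a, h a ≠ ∞ := by
    intro a
    simp only [h]
    by_cases ha : a ∈ I
    · have := hI a ha
      rw [indicator_of_mem ha]
      rw [Ne, ENNReal.rpow_eq_top_iff]
      simp
      omega
    · simp [ha]
  let g : ℕ → ℝ≥0∞ := {a | a ∈ I ∧ m ≤ a}.indicator fun a : ℕ => ((a : ℝ≥0∞) + 2) ^ (-(s : ℝ))
  have htail : ∑' a, h (a + m) = ∞ := by
    rw [← Summable.sum_add_tsum_nat_add' (k := m) ENNReal.summable, ENNReal.add_eq_top] at hA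
    exact hA.resolve_left (ENNReal.sum_ne_top.2 fun a _ => hh a)
  have hg : ∑' a, g a = ∞ := by
    -- Since elements of `A` are at least 1, `b + 2 ≤ 3 * b`; the shift by 2 therefore preserves
    -- divergence.
    have h3 : ∀ a, h (a + m) ≤ 3 ^ (s : ℝ) * g (a + m) := by
      intro a
      simp only [h, g]
      by_cases ha : a + m ∈ I
      · have h1 := hI _ ha
        rw [indicator_of_mem ha, indicator_of_mem (show a + m ∈ {a | a ∈ I ∧ m ≤ a} from
          ⟨ha, by omega⟩)]
        generalize a + m = b at h1
        have h0 : (3 : ℝ≥0∞) ^ (s : ℝ) ≠ 0 := by simp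
        have h0' : (3 : ℝ≥0∞) ^ (s : ℝ) ≠ ∞ := ENNReal.rpow_ne_top_of_nonneg s.coe_nonneg (by simp)
        have hb : ((b : ℝ≥0∞) + 2) ^ (s : ℝ) ≤ 3 ^ (s : ℝ) * (b : ℝ≥0∞) ^ (s : ℝ) := by
          rw [← ENNReal.mul_rpow_of_nonneg _ _ s.coe_nonneg]
          refine ENNReal.rpow_le_rpow ?_ s.coe_nonneg
          have : b + 2 ≤ 3 * b := by omega
          exact_mod_cast this
        rw [ENNReal.rpow_neg, ENNReal.rpow_neg, ← inv_inv ((3 : ℝ≥0∞) ^ (s : ℝ)),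
          ← ENNReal.mul_inv (Or.inl (by simp [h0'])) (Or.inl (by simp [h0])), ENNReal.inv_le_inv]
        calc _ ≤ ((3 : ℝ≥0∞) ^ (s : ℝ))⁻¹ * (3 ^ (s : ℝ) * (b : ℝ≥0∞) ^ (s : ℝ)) := by gcongr
          _ = _ := by rw [← mul_assoc, ENNReal.inv_mul_cancel h0 h0', one_mul]
      · rw [indicator_of_notMem ha]
        exact zero_le
    have h1 := htail.symm.trans_le (ENNReal.tsum_le_tsum h3)
    rw [ENNReal.tsum_mul_left, top_le_iff, ENNReal.mul_eq_top] at h1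
    have h2 : ∑' a, g (a + m) = ∞ := by
      rcases h1 with h1 | h1
      · exact h1.2
      · exact absurd h1.1 (ENNReal.rpow_ne_top_of_nonneg s.coe_nonneg (by simp))
    rw [← Summable.sum_add_tsum_nat_add' (k := m) ENNReal.summable, h2, add_top]
  have hg1 : ∀ a, g a ≤ ((a : ℝ≥0∞) + 2) ^ (-(s : ℝ)) := fun a => indicator_le_self _ _ a
  rw [ENNReal.tsum_eq_iSup_sum] at hg
  -- A finite partial sum exceeding 1 suffices: normalizing then only decreases the weights, so the
  -- bound on them survives.
  obtain ⟨F, hF⟩ := lt_iSup_iff.1 (hg ▸ ENNReal.one_lt_top)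
  let f : ℕ → ℝ≥0∞ := (F : Set ℕ).indicator g
  have hf : ∑' a, f a = ∑ a ∈ F, g a := by
    rw [tsum_eq_sum fun a ha => indicator_of_notMem (show a ∉ (F : Set ℕ) from ha) g]
    exact Finset.sum_congr rfl fun a ha => indicator_of_mem (show a ∈ (F : Set ℕ) from ha) g
  have hf0 : ∑' a, f a ≠ 0 := by
    rw [hf]
    exact (one_pos.trans hF).ne'
  have hftop : ∑' a, f a ≠ ∞ := by
    rw [hf]
    refine ENNReal.sum_ne_top.2 fun a _ => ne_top_of_le_ne_top ?_ (hg1 a)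
    simp [ENNReal.rpow_eq_top_iff]
  refine ⟨PMF.normalize f hf0 hftop, fun a => ?_, ?_⟩
  · rw [PMF.normalize_apply]
    calc f a * (∑' a, f a)⁻¹ ≤ f a * 1 := by
          gcongr
          rw [ENNReal.inv_le_one, hf]
          exact hF.le
      _ = f a := mul_one _
      _ ≤ g a := indicator_le_self _ _ a
      _ ≤ _ := hg1 a
  · rw [PMF.support_normalize]
    intro a ha
    have hga : g a ≠ 0 := fun h0 => ha (le_antisymm ((indicator_le_self _ _ a).trans_eq h0) zero_le)
    exact mem_of_indicator_ne_zero hga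

theorem hausdorffMeasure_escapingSet_ne_zero [MeasurableSpace GaussBaire] [BorelSpace GaussBaire]
    {A : Set ℕ+} {s : ℝ≥0} (hs : 0 < s) (hA : zetaSum A s = ∞) :
    Measure.hausdorffMeasure ((s / 2 : ℝ≥0) : ℝ) (escapingSet A) ≠ 0 := by
  choose p hp hsupp using exists_pmf_of_zetaSum_eq_top hA
  set t : ℝ := ((s / 2 : ℝ≥0) : ℝ)
  have ht : 0 < t := NNReal.coe_pos.2 (half_pos hs)
  -- The `n`-th coordinate is drawn from `A ∩ [n, ∞)`, so almost every sequence satisfies `z n ≥ n`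
  -- and tends to infinity.
  let μ : Measure (ℕ → ℕ) := Measure.infinitePi fun n => (p n).toMeasure
  refine GaussBaire.hausdorffMeasure_ne_zero_of_cylinder_le ht (μ := μ) (c := (4 ^ t)⁻¹)
    (by simp) (fun z n => ?_) ?_
  · have hcyl : μ (PiNat.cylinder z n) = ∏ i ∈ Finset.range n, p i (z i) := by
      rw [PiNat.cylinder_eq_pi, Measure.infinitePi_pi _ fun _ _ => MeasurableSet.of_discrete]
      refine Finset.prod_congr rfl fun i _ => ?_
      rw [PMF.toMeasure_apply_singleton _ _ (MeasurableSet.singleton _)]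
    -- With `t = s / 2`, `(a + 2)^(-s)` is the `t`-th power of `(a + 2)^(-2)`; the 4 is the constant
    -- of `prod_le_gaussCyl`.
    have hle : μ (PiNat.cylinder z n) ≤ 4 ^ t * gaussCyl z n ^ t := by
      rw [hcyl, ← ENNReal.mul_rpow_of_nonneg _ _ ht.le]
      refine le_trans ?_ (ENNReal.rpow_le_rpow (prod_le_gaussCyl z n) ht.le)
      rw [← ENNReal.prod_rpow_of_nonneg ht.le]
      refine Finset.prod_le_prod' fun i _ => (hp i (z i)).trans_eq ?_
      rw [← ENNReal.rpow_mul]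
      congr 1
      simp only [t]
      push_cast
      ring
    rw [mul_comm, ← div_eq_mul_inv]
    exact ENNReal.div_le_of_le_mul' hle
  · have hae : ∀ᵐ z ∂μ, ∀ n, z n ∈ {a | a ∈ ((↑) : ℕ+ → ℕ) '' A ∧ n ≤ a} := by
      rw [ae_all_iff]
      intro n
      have hn : ∀ᵐ a ∂(p n).toMeasure, a ∈ {a | a ∈ ((↑) : ℕ+ → ℕ) '' A ∧ n ≤ a} := by
        rw [ae_iff, PMF.toMeasure_apply_eq_zero_iff _ MeasurableSet.of_discrete]
        exact disjoint_left.2 fun a ha ha' => ha' (hsupp n ha)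
      exact (measurePreserving_eval_infinitePi _ n).quasiMeasurePreserving.ae hn
    have huniv : ∀ᵐ z ∂μ, z ∈ GaussBaire.mk ⁻¹' escapingSet A := by
      filter_upwards [hae] with z hz
      exact ⟨fun n => (hz n).1, tendsto_atTop_mono (fun n => (hz n).2) tendsto_id⟩
    intro h0
    have : ∀ᵐ z ∂μ, False := by
      filter_upwards [huniv, measure_eq_zero_iff_ae_notMem.1 h0] with z h1 h2 using h2 h1
    simp [μ, IsProbabilityMeasure.ne_zero] at this

theorem zetaDim_le_two_mul_dimH_escapingSet (A : Set ℕ+) :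
    zetaDim A ≤ 2 * dimH (escapingSet A) := by
  borelize GaussBaire
  by_contra! hlt
  obtain ⟨s, hs, hsA⟩ := ENNReal.lt_iff_exists_nnreal_btwn.1 hlt
  have htop : zetaSum A s = ∞ := by
    by_contra h
    exact hsA.not_ge (iInf₂_le s (lt_top_iff_ne_top.2 h))
  have hs0 : 0 < s := ENNReal.coe_pos.1 (zero_le.trans_lt hs)
  have hle := le_dimH_of_hausdorffMeasure_ne_zero (hausdorffMeasure_escapingSet_ne_zero hs0 htop)
  refine hs.not_ge ?_
  calc (s : ℝ≥0∞) = 2 * ((s / 2 : ℝ≥0) : ℝ≥0∞) := by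
        rw [← ENNReal.coe_ofNat, ← ENNReal.coe_mul, mul_div_cancel₀ _ two_ne_zero]
    _ ≤ _ := by gcongr

/-! ### Conclusion: the three inequalities close into a cycle. -/

theorem theorem4p2 (A : Set ℕ+) :
    zetaDim A = 2 * dimH (escapingSet A) ∧
      2 * dimH (escapingSet A) = 2 * packingDim (escapingSet A) := by
  have h1 := zetaDim_le_two_mul_dimH_escapingSet A
  have h2 : 2 * dimH (escapingSet A) ≤ 2 * packingDim (escapingSet A) := by
    gcongr
    exact dimH_le_packingDim _
  have h3 := two_mul_packingDim_escapingSet_le A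
  exact ⟨le_antisymm h1 (h2.trans h3), le_antisymm h2 (h3.trans h1)⟩
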